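/- All graphs are finite and simple. For a graph $G$, let $\lambda(G)$ be its spectral radius, i.e. the maximum absolute value of the eigenvalues of its adjacency matrix ($\lambda(G)=0$ if $G$ has no vertices), and for $\ell\ge 1$ let $w_\ell(G)$ be the number of sequences $(v_1,\dots,v_\ell)$ of vertices of $G$ such that $v_i$ is adjacent to $v_{i+1}$ for all $1\le i\le \ell-1$. A graph $G$ is $F$-free if it has no subgraph (not necessarily induced) isomorphic to $F$. Theorem. Let $F$ be a graph with chromatic number $\chi(F)=r+1\ge 3$ and let $\ell\ge 1$ be an integer. Then there is a function $f=f_{\ell,F}\colon\mathbb{N}\to\mathbb{R}$ with $f(w)\to 0$ as $w\to\infty$ such that every $F$-free graph $G$ satisfies $$\lambda(G)^\ell\le\Bigl(1-\frac1r+f\bigl(w_\ell(G)\bigr)\Bigr)\,w_\ell(G).$$ In other words, $\lambda^\ell(G)\le\bigl(1-\frac1r+o_{\ell,F}(1)\bigr)w_\ell(G)$, where $o_{\ell,F}(1)$ tends to $0$ as $w_\ell(G)\to\infty$, for fixed $\ell$ and $F$ and uniformly over all $F$-free graphs $G$. -/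

import Mathlib

open Filter Topology

namespace SimpleGraph

/-- The spectral radius of a finite graph: the maximum absolute value of the (real) eigenvalues of
its adjacency matrix (and `0` for the graph without vertices). -/
noncomputable def adjSpectralRadius {W : Type*} [Fintype W] (G : SimpleGraph W) : ℝ := by
  classical
  exact (spectralRadius ℝ (G.adjMatrix ℝ)).toReal

/-- A sequence of `l` vertices is an `l`-walk if any two consecutive ones are adjacent. -/
def IsVertexWalk {W : Type*} (G : SimpleGraph W) (l : ℕ) (v : Fin l → W) : Prop :=
  ∀ i j : Fin l, (i : ℕ) + 1 = (j : ℕ) → G.Adj (v i) (v j)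

/-- The number of `l`-walks (walks on `l` vertices) of a finite graph. -/
noncomputable def walkCount {W : Type*} [Fintype W] (G : SimpleGraph W) (l : ℕ) : ℕ :=
  Nat.card {v : Fin l → W // G.IsVertexWalk l v}

end SimpleGraph

/-! Let `x` be a nonnegative unit eigenvector for the spectral radius λ. Then p_ij = A_ij x_i x_j /
λ is a distribution on ordered edges with both marginals x_i². Comparing its analogue for A^(ℓ-1)
with A^(ℓ-1) / w_ℓ gives log(λ^ℓ / w_ℓ) ≤ ∑ p_ij log(λ x_i x_j), which is minus the relative entropy
of p with respect to q_ij = x_i² x_j² (`exists_log_pow_sub_log_walkCount_le`).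

So λ^ℓ / w_ℓ is at most about the q-measure of any edge set carrying almost all of p. By
`sum_mul_log_le_of_sum_typical_le` it is enough to measure the edges with 1/K ≤ λ x_i x_j ≤ K. In a
triangle abd of such edges, λ x_a² = (λ x_a x_b)(λ x_a x_d) / (λ x_b x_d) ≤ K³, so for large λ
triangle vertices have small weight. That is what a weighted Erdős–Stone theorem needs
(`exists_forall_sum_adj_mul_le`): vertices outside triangles may be heavy, but a complete
(r+1)-partite graph with r ≥ 2 cannot use them. If λ stays bounded, the claim is trivial for large
w_ℓ. -/

/-! ### Entropy inequalities -/

/-- The log-sum inequality for a matrix with a positive eigenvector, expressed through the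
entropy of the squared eigenvector. -/
theorem Matrix.log_eigenvalue_sub_le_log_sum {W : Type*} [Fintype W] {B : Matrix W W ℝ}
    (hB : B.IsSymm) (hB0 : ∀ i j, 0 ≤ B i j) {x : W → ℝ} (hx0 : ∀ i, 0 ≤ x i)
    (hx1 : ∑ i, x i ^ 2 = 1) {c : ℝ} (hc : 0 < c) (hBx : B.mulVec x = c • x)
    (hpos : 0 < ∑ i, ∑ j, B i j) :
    Real.log c - 2 * ∑ i, x i ^ 2 * Real.log (x i) ≤ Real.log (∑ i, ∑ j, B i j) := by
  set S := ∑ i, ∑ j, B i j with hS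
  have hrow : ∀ i, ∑ j, B i j * x j = c * x i := fun i => by
    simpa [Matrix.mulVec, dotProduct] using congrFun hBx i
  have hrowp : ∀ i, ∑ j, B i j * x i * x j / c = x i ^ 2 := fun i => by
    have : ∀ j, B i j * x i * x j / c = (x i / c) * (B i j * x j) := fun j => by ring
    simp_rw [this]
    rw [← Finset.mul_sum, hrow]
    field_simp
  have hpt : ∀ i j, B i j * x i * x j / c *
      (Real.log c - Real.log S - Real.log (x i) - Real.log (x j)) ≤
        B i j / S - B i j * x i * x j / c := by
    intro i j
    rcases (hB0 i j).eq_or_lt with hb | hb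
    · simp [← hb]
    rcases (hx0 i).eq_or_lt with hi | hi
    · simp only [← hi, mul_zero, zero_mul, zero_div, sub_zero]; positivity
    rcases (hx0 j).eq_or_lt with hj | hj
    · simp only [← hj, mul_zero, zero_mul, zero_div, sub_zero]; positivity
    -- This is the ratio of B_ij / S to B_ij x_i x_j / c; both have total mass 1, so the bounds log
    -- u ≤ u - 1 sum to zero.
    have hl := Real.log_le_sub_one_of_pos (x := c / (S * x i * x j)) (by positivity)
    rw [Real.log_div (by positivity) (by positivity), Real.log_mul (by positivity) (by positivity),
      Real.log_mul (by positivity) (by positivity)] at hl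
    have hp : 0 < B i j * x i * x j / c := by positivity
    calc _ ≤ B i j * x i * x j / c * (c / (S * x i * x j) - 1) := by
          apply mul_le_mul_of_nonneg_left _ hp.le; linarith
      _ = _ := by field_simp
  have hsum := Finset.sum_le_sum fun i (_ : i ∈ Finset.univ) =>
    Finset.sum_le_sum fun j (_ : j ∈ Finset.univ) => hpt i j
  have e1 : ∑ i, ∑ j, (B i j / S - B i j * x i * x j / c) = 0 := by
    simp_rw [Finset.sum_sub_distrib, hrowp, hx1, ← Finset.sum_div]
    rw [← hS, div_self hpos.ne', sub_self]
  have e2 : ∑ i, ∑ j, B i j * x i * x j / c *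
      (Real.log c - Real.log S - Real.log (x i) - Real.log (x j)) =
      Real.log c - Real.log S - 2 * ∑ i, x i ^ 2 * Real.log (x i) := by
    have a1 : ∑ i, ∑ j, B i j * x i * x j / c *
        (Real.log c - Real.log S - Real.log (x i)) =
        Real.log c - Real.log S - ∑ i, x i ^ 2 * Real.log (x i) := by
      simp_rw [← Finset.sum_mul, hrowp, mul_sub, Finset.sum_sub_distrib, ← Finset.sum_mul, hx1,
        one_mul]
    have a2 : ∑ i, ∑ j, B i j * x i * x j / c * Real.log (x j) =
        ∑ i, x i ^ 2 * Real.log (x i) := by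
      rw [Finset.sum_comm]
      refine Finset.sum_congr rfl fun j _ => ?_
      rw [← Finset.sum_mul, ← hrowp j]
      congr 1
      refine Finset.sum_congr rfl fun i _ => ?_
      rw [← hB.apply i j]; ring
    simp_rw [mul_sub _ (_ - Real.log (x _)), Finset.sum_sub_distrib]
    rw [a1, a2]; ring
  rw [e1, e2] at hsum
  linarith

/-- The logarithm splits into three terms, and each of the last two sees only a marginal, which is
x_i². Vanishing x_i are harmless because their coefficient is zero. -/
theorem Matrix.sum_mul_log_eigenvector {W : Type*} [Fintype W] {A : Matrix W W ℝ}
    (hA : A.IsSymm) {x : W → ℝ} (hx1 : ∑ i, x i ^ 2 = 1) {c : ℝ} (hc : 0 < c)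
    (hAx : A.mulVec x = c • x) :
    ∑ i, ∑ j, A i j * x i * x j / c * Real.log (c * x i * x j) =
      Real.log c + 2 * ∑ i, x i ^ 2 * Real.log (x i) := by
  have hrow : ∀ i, ∑ j, A i j * x j = c * x i := fun i => by
    simpa [Matrix.mulVec, dotProduct] using congrFun hAx i
  have hrowp : ∀ i, ∑ j, A i j * x i * x j / c = x i ^ 2 := fun i => by
    have : ∀ j, A i j * x i * x j / c = (x i / c) * (A i j * x j) := fun j => by ring
    simp_rw [this]
    rw [← Finset.mul_sum, hrow]
    field_simp
  have hpt : ∀ i j, A i j * x i * x j / c * Real.log (c * x i * x j) =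
      A i j * x i * x j / c * (Real.log c + Real.log (x i)) +
        A i j * x i * x j / c * Real.log (x j) := by
    intro i j
    by_cases hi : x i = 0
    · simp [hi]
    by_cases hj : x j = 0
    · simp [hj]
    rw [Real.log_mul (mul_ne_zero hc.ne' hi) hj, Real.log_mul hc.ne' hi]; ring
  have a1 : ∑ i, ∑ j, A i j * x i * x j / c * (Real.log c + Real.log (x i)) =
      Real.log c + ∑ i, x i ^ 2 * Real.log (x i) := by
    simp_rw [← Finset.sum_mul, hrowp, mul_add, Finset.sum_add_distrib, ← Finset.sum_mul, hx1,
      one_mul]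
  have a2 : ∑ i, ∑ j, A i j * x i * x j / c * Real.log (x j) =
      ∑ i, x i ^ 2 * Real.log (x i) := by
    rw [Finset.sum_comm]
    refine Finset.sum_congr rfl fun j _ => ?_
    rw [← Finset.sum_mul, ← hrowp j]
    congr 1
    refine Finset.sum_congr rfl fun i _ => ?_
    rw [← hA.apply i j]; ring
  simp_rw [hpt, Finset.sum_add_distrib]
  rw [a1, a2]; ring

/-- A bound for relative entropy when the likelihood ratio `t` is typically neither large nor
small, and the reference measure of its typical range is at most `s`. -/
theorem sum_mul_log_le_of_sum_typical_le {ι : Type*} [Fintype ι] {p b t : ι → ℝ}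
    (hp : ∀ i, 0 ≤ p i) (hb : ∀ i, 0 ≤ b i) (hpt : ∀ i, p i * t i = b i)
    (ht : ∀ i, p i ≠ 0 → 0 < t i) (hp1 : ∑ i, p i = 1) (hb1 : ∑ i, b i ≤ 1)
    {K s : ℝ} (hK : 1 < K) (hs : 1 / 2 ≤ s) (hs1 : s ≤ 1)
    (hS : ∑ i with 1 / K ≤ t i ∧ t i ≤ K, b i ≤ s)
    (hL : -1 ≤ ∑ i, p i * Real.log (t i)) :
    ∑ i, p i * Real.log (t i) ≤ Real.log s + (8 / Real.log K + 2 / K + 2 / √K) := by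
  classical
  have hK0 : 0 < K := by linarith
  have hlK : 0 < Real.log K := Real.log_pos hK
  have hs0 : 0 < s := by linarith
  set g := ∑ i with 1 / K ≤ t i ∧ t i ≤ K, p i with hg
  set l := ∑ i with t i < 1 / K, p i with hl
  set h := ∑ i with K < t i, p i with hh
  have hKK : 1 / K ≤ K := by
    rw [div_le_iff₀ hK0]; nlinarith
  have htot : g + l + h = 1 := by
    rw [← hp1, hg, hl, hh, Finset.sum_filter, Finset.sum_filter, Finset.sum_filter,
      ← Finset.sum_add_distrib, ← Finset.sum_add_distrib]
    refine Finset.sum_congr rfl fun i _ => ?_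
    by_cases h1 : t i < 1 / K
    · rw [if_neg fun h' => h1.not_ge h'.1, if_pos h1, if_neg (by linarith), zero_add, add_zero]
    · by_cases h2 : K < t i
      · rw [if_neg fun h' => h2.not_ge h'.2, if_neg h1, if_pos h2, zero_add, zero_add]
      · rw [if_pos ⟨not_lt.mp h1, not_lt.mp h2⟩, if_neg h1, if_neg h2, add_zero, add_zero]
  have hg0 : 0 ≤ g := Finset.sum_nonneg fun i _ => hp i
  have hl0 : 0 ≤ l := Finset.sum_nonneg fun i _ => hp i
  have hh0 : 0 ≤ h := Finset.sum_nonneg fun i _ => hp i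
  have hhK : h ≤ 1 / K := by
    calc h ≤ ∑ i with K < t i, b i / K := by
          refine Finset.sum_le_sum fun i hi => ?_
          rw [le_div_iff₀ hK0, ← hpt]
          exact mul_le_mul_of_nonneg_left (Finset.mem_filter.mp hi).2.le (hp i)
      _ ≤ ∑ i, b i / K := Finset.sum_le_sum_of_subset_of_nonneg (Finset.filter_subset _ _)
          fun i _ _ => div_nonneg (hb i) hK0.le
      _ ≤ 1 / K := by rw [← Finset.sum_div]; gcongr
  have hpoint : ∀ i, p i * Real.log (t i) ≤
      (if 1 / K ≤ t i ∧ t i ≤ K then p i * Real.log s + b i / s - p i else 0) +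
      (if t i < 1 / K then -(p i * Real.log K) else 0) + 2 / √K * b i := by
    intro i
    have hsK : 0 < √K := Real.sqrt_pos.mpr hK0
    have hlast : 0 ≤ 2 / √K * b i := mul_nonneg (by positivity) (hb i)
    by_cases hpi : p i = 0
    · have : b i = 0 := by rw [← hpt, hpi, zero_mul]
      simp [hpi, this]
    have hti := ht i hpi
    by_cases h1 : t i < 1 / K
    · rw [if_neg (by intro h'; linarith [h'.1]), if_pos h1]
      have : Real.log (t i) ≤ - Real.log K := by
        rw [← Real.log_inv]
        exact Real.log_le_log hti (by rw [← one_div]; exact h1.le)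
      nlinarith [mul_le_mul_of_nonneg_left this (hp i)]
    by_cases h2 : t i ≤ K
    · rw [if_pos ⟨not_lt.mp h1, h2⟩, if_neg h1]
      have := Real.log_le_sub_one_of_pos (div_pos hti hs0)
      rw [Real.log_div hti.ne' hs0.ne'] at this
      have := mul_le_mul_of_nonneg_left this (hp i)
      have e : p i * (t i / s - 1) = b i / s - p i := by rw [← hpt]; ring
      rw [e, mul_sub] at this
      linarith
    · rw [if_neg (by tauto), if_neg h1]
      push Not at h2
      -- Beyond K, log t ≤ 2√t ≤ 2t/√K, so these terms are charged to `b`.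
      have hst : 0 < √(t i) := Real.sqrt_pos.mpr hti
      have h3 := Real.log_le_sub_one_of_pos hst
      rw [Real.log_sqrt hti.le] at h3
      have h4 : Real.log (t i) ≤ 2 * √(t i) := by linarith
      have h5 : √(t i) ≤ t i / √K := by
        rw [le_div_iff₀ hsK]
        calc √(t i) * √K ≤ √(t i) * √(t i) := by gcongr
          _ = t i := Real.mul_self_sqrt hti.le
      calc p i * Real.log (t i) ≤ p i * (2 * (t i / √K)) := by
            apply mul_le_mul_of_nonneg_left _ (hp i); linarith
        _ = 0 + 0 + 2 / √K * b i := by rw [← hpt]; ring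
  have hsum := Finset.sum_le_sum fun i (_ : i ∈ Finset.univ) => hpoint i
  rw [Finset.sum_add_distrib, Finset.sum_add_distrib, ← Finset.sum_filter, ← Finset.sum_filter,
    Finset.sum_sub_distrib, Finset.sum_add_distrib, ← Finset.sum_mul, ← Finset.sum_div,
    Finset.sum_neg_distrib, ← Finset.sum_mul, ← Finset.mul_sum, ← hg, ← hl] at hsum
  set L := ∑ i, p i * Real.log (t i)
  have hSs : (∑ i with 1 / K ≤ t i ∧ t i ≤ K, b i) / s ≤ 1 := by
    rw [div_le_one hs0]; exact hS
  have hsq : 2 / √K * ∑ i, b i ≤ 2 / √K := by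
    apply mul_le_of_le_one_right (by positivity) hb1
  have hsqK : 2 / √K ≤ 2 := by
    apply div_le_self (by norm_num)
    rw [Real.one_le_sqrt]; exact hK.le
  have hls : -1 ≤ Real.log s := by
    have := Real.one_sub_inv_le_log_of_pos hs0
    have h2 : s⁻¹ ≤ 2 := by
      rw [inv_le_comm₀ hs0 (by norm_num)]; linarith
    linarith
  have hls0 : Real.log s ≤ 0 := Real.log_nonpos hs0.le hs1
  -- Each unit of mass below 1/K costs log K, so the lower bound -1 on the whole sum makes this mass
  -- small.
  have hl4 : l * Real.log K ≤ 4 := by nlinarith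
  have hl5 : l ≤ 4 / Real.log K := by rwa [le_div_iff₀ hlK]
  have hlK0 : 0 ≤ l * Real.log K := by positivity
  have e8 : 8 / Real.log K = 2 * (4 / Real.log K) := by ring
  have e2 : 2 / K = 2 * (1 / K) := by ring
  have : g = 1 - l - h := by linarith
  rw [e8, e2]
  nlinarith

/-! ### Perron eigenvector -/

/-- **Perron–Frobenius** for symmetric matrices with nonnegative entries. -/
theorem Matrix.exists_nonneg_eigenvector_spectralRadius {W : Type*} [Fintype W] [DecidableEq W]
    [Nonempty W] {A : Matrix W W ℝ} (hA : A.IsSymm) (hA0 : ∀ i j, 0 ≤ A i j) :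
    ∃ x : W → ℝ, (∀ i, 0 ≤ x i) ∧ ∑ i, x i ^ 2 = 1 ∧
      A.mulVec x = (spectralRadius ℝ A).toReal • x := by
  have hH : A.IsHermitian := by
    rw [Matrix.IsHermitian, Matrix.conjTranspose_eq_transpose_of_trivial]; exact hA
  obtain ⟨k, hk⟩ := Finite.exists_max fun i => |hH.eigenvalues i|
  set c := (spectralRadius ℝ A).toReal with hc
  have hck : c = |hH.eigenvalues k| := by
    have : spectralRadius ℝ A = ‖hH.eigenvalues k‖₊ := by
      rw [spectralRadius, hH.spectrum_real_eq_range_eigenvalues, iSup_range]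
      refine le_antisymm (iSup_le fun i => ?_)
        (le_iSup (fun i => (‖hH.eigenvalues i‖₊ : ENNReal)) k)
      exact_mod_cast hk i
    rw [hc, this]; simp
  set u : W → ℝ := ⇑(hH.eigenvectorBasis k) with hu
  have hAu : A.mulVec u = hH.eigenvalues k • u := hH.mulVec_eigenvectorBasis k
  have hu1 : ∑ i, u i ^ 2 = 1 := by
    have := hH.eigenvectorBasis.orthonormal.1 k
    rw [EuclideanSpace.norm_eq, Real.sqrt_eq_one] at this
    simpa using this
  refine ⟨fun i => |u i|, fun i => abs_nonneg _, by simpa using hu1, ?_⟩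
  set x : W → ℝ := fun i => |u i|
  -- Passing to |u| makes the quadratic form of A at least c, so the form of the positive
  -- semidefinite c - A vanishes at x, which puts x in its kernel.
  have hPSD : (c • (1 : Matrix W W ℝ) - A).PosSemidef := by
    have hH' : (c • (1 : Matrix W W ℝ) - A).IsHermitian := by
      refine Matrix.IsHermitian.sub ?_ hH
      simp [Matrix.IsHermitian]
    rw [hH'.posSemidef_iff_eigenvalues_nonneg]
    intro i
    have hm := hH'.eigenvalues_mem_spectrum_real i
    have h1 : c - hH'.eigenvalues i ∈ spectrum ℝ A := by
      rw [spectrum.mem_iff] at hm ⊢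
      rw [← IsUnit.neg_iff] at hm
      convert hm using 2
      rw [map_sub, Algebra.algebraMap_eq_smul_one c]
      abel
    rw [hH.spectrum_real_eq_range_eigenvalues] at h1
    obtain ⟨j, hj⟩ := h1
    have := (le_abs_self _).trans (hk j)
    simp only [Pi.zero_apply]
    linarith
  have hxx : x ⬝ᵥ x = 1 := by
    rw [← hu1]; simp [dotProduct, x, sq]
  have hge : c ≤ x ⬝ᵥ A.mulVec x := by
    have h1 : u ⬝ᵥ A.mulVec u = hH.eigenvalues k := by
      rw [hAu, dotProduct_smul, smul_eq_mul]
      have : u ⬝ᵥ u = 1 := by rw [← hu1]; simp [dotProduct, sq]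
      rw [this, mul_one]
    rw [hck, ← h1]
    simp only [dotProduct, Matrix.mulVec, x]
    refine (Finset.abs_sum_le_sum_abs _ _).trans (Finset.sum_le_sum fun i _ => ?_)
    rw [abs_mul]
    refine mul_le_mul_of_nonneg_left ?_ (abs_nonneg _)
    refine (Finset.abs_sum_le_sum_abs _ _).trans (Finset.sum_le_sum fun j _ => ?_)
    rw [abs_mul, abs_of_nonneg (hA0 i j)]
  have hz : star x ⬝ᵥ (c • (1 : Matrix W W ℝ) - A).mulVec x = 0 := by
    refine le_antisymm ?_ (hPSD.dotProduct_mulVec_nonneg x)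
    rw [star_trivial, Matrix.sub_mulVec, Matrix.smul_mulVec, Matrix.one_mulVec, dotProduct_sub,
      dotProduct_smul, hxx, smul_eq_mul]
    linarith
  rw [hPSD.dotProduct_mulVec_zero_iff, Matrix.sub_mulVec, Matrix.smul_mulVec, Matrix.one_mulVec,
    sub_eq_zero] at hz
  exact hz.symm

/-! ### Walk counts as matrix powers -/

namespace SimpleGraph

variable {W : Type*} [Fintype W] (G : SimpleGraph W)

theorem isVertexWalk_cons {W : Type*} (G : SimpleGraph W) {k : ℕ} (a : W) (v : Fin (k + 1) → W) :
    G.IsVertexWalk (k + 2) (Fin.cons a v) ↔ G.Adj a (v 0) ∧ G.IsVertexWalk (k + 1) v := by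
  constructor
  · intro h
    refine ⟨by simpa using h 0 1 (by simp), fun i j hij => ?_⟩
    simpa using h i.succ j.succ (by simp [hij])
  · rintro ⟨h0, h⟩ i j hij
    obtain rfl | ⟨j, rfl⟩ := j.eq_zero_or_eq_succ
    · simp at hij
    obtain rfl | ⟨i, rfl⟩ := i.eq_zero_or_eq_succ
    · have : j = 0 := by ext; simpa using hij.symm
      subst this
      simpa using h0
    · simpa using h i j (by simpa using hij)

-- The arbitrary weight on the first vertex carries the induction: summing over a prepended vertex
-- replaces `g` by `g` times the adjacency matrix.
open Classical in
theorem sum_isVertexWalk_eq_dotProduct (k : ℕ) (g : W → ℝ) :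
    ∑ v : Fin (k + 1) → W, (if G.IsVertexWalk (k + 1) v then g (v 0) else 0) =
      g ⬝ᵥ (G.adjMatrix ℝ ^ k).mulVec 1 := by
  induction k generalizing g with
  | zero =>
    have : ∀ v : Fin (0 + 1) → W, G.IsVertexWalk (0 + 1) v := fun v i j h => by omega
    simp only [this, if_true, pow_zero, Matrix.one_mulVec, dotProduct_one]
    exact (Equiv.funUnique (Fin 1) W).sum_comp g
  | succ k ih =>
    rw [← (Fin.consEquiv fun _ : Fin (k + 1 + 1) => W).sum_comp, Fintype.sum_prod_type,
      Finset.sum_comm, pow_succ', ← Matrix.mulVec_mulVec, Matrix.dotProduct_mulVec, ← ih]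
    refine Finset.sum_congr rfl fun v _ => ?_
    have hcons : ∀ a : W, G.IsVertexWalk (k + 1 + 1) (Fin.consEquiv (fun _ => W) (a, v)) ↔
        G.Adj a (v 0) ∧ G.IsVertexWalk (k + 1) v := fun a => G.isVertexWalk_cons a v
    simp only [hcons]
    by_cases h : G.IsVertexWalk (k + 1) v
    · simp [h, Matrix.vecMul, dotProduct, adjMatrix_apply]
    · simp [h]

open Classical in
theorem walkCount_succ (k : ℕ) :
    (G.walkCount (k + 1) : ℝ) = ∑ i, ∑ j, (G.adjMatrix ℝ ^ k) i j := by
  have := G.sum_isVertexWalk_eq_dotProduct k 1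
  rw [walkCount, Nat.card_eq_fintype_card, Fintype.card_subtype, Finset.card_filter]
  push_cast
  simpa [dotProduct, Matrix.mulVec] using this

end SimpleGraph

/-! ### Independent sampling -/

theorem sum_prod_mul_apply {W : Type*} [Fintype W] {p : W → ℝ} (hp : ∑ a, p a = 1) {n : ℕ}
    (j : Fin n) (g : W → ℝ) :
    ∑ v : Fin n → W, (∏ k, p (v k)) * g (v j) = ∑ a, p a * g a := by
  obtain _ | n := n
  · exact j.elim0
  rw [← (Fin.insertNthEquiv (fun _ => W) j).sum_comp, Fintype.sum_prod_type]
  refine Finset.sum_congr rfl fun a _ => ?_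
  have h1 : ∑ v : Fin n → W, ∏ k, p (v k) = 1 := by
    rw [← Fintype.prod_sum]; simp [hp]
  calc _ = ∑ v : Fin n → W, (∏ k, p (v k)) * (p a * g a) := by
        refine Finset.sum_congr rfl fun v _ => ?_
        simp only [Fin.prod_univ_succAbove _ j, Fin.insertNthEquiv_apply, Fin.insertNth_apply_same,
          Fin.insertNth_apply_succAbove]
        ring
    _ = _ := by rw [← Finset.sum_mul, h1, one_mul]

theorem sum_prod_mul_apply_apply {W : Type*} [Fintype W] {p : W → ℝ} (hp : ∑ a, p a = 1) {n : ℕ}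
    {i j : Fin n} (hij : j ≠ i) (g : W → W → ℝ) :
    ∑ v : Fin n → W, (∏ k, p (v k)) * g (v i) (v j) = ∑ a, ∑ b, p a * p b * g a b := by
  obtain _ | n := n
  · exact j.elim0
  obtain ⟨j, rfl⟩ := Fin.exists_succAbove_eq hij
  rw [← (Fin.insertNthEquiv (fun _ => W) i).sum_comp, Fintype.sum_prod_type]
  refine Finset.sum_congr rfl fun a _ => ?_
  calc _ = ∑ v : Fin n → W, (∏ k, p (v k)) * (p a * g a (v j)) := by
        refine Finset.sum_congr rfl fun v _ => ?_
        simp only [Fin.prod_univ_succAbove _ i, Fin.insertNthEquiv_apply, Fin.insertNth_apply_same,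
          Fin.insertNth_apply_succAbove]
        ring
    _ = _ := by
        rw [sum_prod_mul_apply hp j fun b => p a * g a b]
        exact Finset.sum_congr rfl fun b _ => by ring

/-- If `φ` has mean `θ` under two independent samples from `p`, some sequence of `n` points
has average at least `θ` over its pairs of distinct positions. -/
theorem exists_le_sum_offDiag_apply {W : Type*} [Fintype W] {p : W → ℝ} (hp0 : ∀ a, 0 ≤ p a)
    (hp : ∑ a, p a = 1) (n : ℕ) (g : W → W → ℝ) :
    ∃ v : Fin n → W, n * (n - 1) * ∑ a, ∑ b, p a * p b * g a b ≤
      ∑ ij ∈ (Finset.univ : Finset (Fin n)).offDiag, g (v ij.1) (v ij.2) := by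
  have hW : Nonempty W := by
    by_contra h
    rw [not_nonempty_iff] at h
    simp at hp
  obtain ⟨v, hv⟩ := Finite.exists_max fun v : Fin n → W =>
    ∑ ij ∈ (Finset.univ : Finset (Fin n)).offDiag, g (v ij.1) (v ij.2)
  refine ⟨v, ?_⟩
  have h1 : ∑ v : Fin n → W, ∏ k, p (v k) = 1 := by
    rw [← Fintype.prod_sum]; simp [hp]
  calc (n : ℝ) * (n - 1) * ∑ a, ∑ b, p a * p b * g a b
      = ∑ v : Fin n → W, (∏ k, p (v k)) *
          ∑ ij ∈ (Finset.univ : Finset (Fin n)).offDiag, g (v ij.1) (v ij.2) := by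
        have h2 : ∑ v : Fin n → W, (∏ k, p (v k)) *
            ∑ ij ∈ (Finset.univ : Finset (Fin n)).offDiag, g (v ij.1) (v ij.2) =
            ∑ ij ∈ (Finset.univ : Finset (Fin n)).offDiag, ∑ a, ∑ b, p a * p b * g a b := by
          simp_rw [Finset.mul_sum]
          rw [Finset.sum_comm]
          exact Finset.sum_congr rfl fun ij hij =>
            sum_prod_mul_apply_apply hp (Finset.mem_offDiag.mp hij).2.2.symm g
        rw [h2, Finset.sum_const, Finset.offDiag_card, nsmul_eq_mul, Finset.card_univ,
          Fintype.card_fin, Nat.cast_sub (Nat.le_mul_self n)]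
        push_cast
        ring
    _ ≤ ∑ w : Fin n → W, (∏ k, p (w k)) *
          ∑ ij ∈ (Finset.univ : Finset (Fin n)).offDiag, g (v ij.1) (v ij.2) :=
        Finset.sum_le_sum fun w _ =>
          mul_le_mul_of_nonneg_left (hv w) (Finset.prod_nonneg fun k _ => hp0 _)
    _ = _ := by rw [← Finset.sum_mul, h1, one_mul]

/-! ### Erdős–Stone, plain and weighted -/

namespace SimpleGraph

open Classical in
/-- A dense graph has a large induced subgraph of large minimum degree. -/
theorem exists_finset_le_card_filter_adj {V : Type*} [Fintype V] (H : SimpleGraph V) {c : ℝ}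
    (hc : 0 ≤ c) :
    ∃ S : Finset V, (∀ v ∈ S, c * S.card ≤ (S.filter (H.Adj v)).card) ∧
      ∑ v, (H.degree v : ℝ) - c * (Fintype.card V * (Fintype.card V + 1)) ≤ (S.card : ℝ) ^ 2 := by
  let a : V → V → ℝ := fun v w => if H.Adj v w then 1 else 0
  have ha : ∀ v (S : Finset V), ((S.filter (H.Adj v)).card : ℝ) = ∑ w ∈ S, a v w := by
    intro v S
    rw [Finset.card_filter]; push_cast; rfl
  -- Deleting v changes the penalty by exactly 2c|S| and the sum by twice the degree of v in S, so
  -- maximality is the degree condition.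
  obtain ⟨S, hS⟩ := Finite.exists_max fun S : Finset V =>
    ∑ v ∈ S, ∑ w ∈ S, a v w - c * (S.card * (S.card + 1))
  refine ⟨S, fun v hv => ?_, ?_⟩
  · have h1 := hS (S.erase v)
    have hcard : ((S.erase v).card : ℝ) = S.card - 1 := by
      rw [Finset.card_erase_of_mem hv, Nat.cast_pred (Finset.card_pos.mpr ⟨v, hv⟩)]
    have e1 : ∑ u ∈ S, ∑ w ∈ S, a u w =
        ∑ u ∈ S.erase v, ∑ w ∈ S.erase v, a u w + 2 * ∑ w ∈ S, a v w := by
      have hvv : a v v = 0 := by simp [a]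
      have hsymm : ∀ u, a u v = a v u := fun u => by simp [a, H.adj_comm]
      rw [← Finset.add_sum_erase S _ hv]
      simp_rw [← Finset.add_sum_erase S (fun w => a _ w) hv, Finset.sum_add_distrib, hsymm, hvv]
      ring
    simp only [hcard] at h1
    rw [ha]
    rw [e1] at h1
    nlinarith
  · have h1 := hS Finset.univ
    have h2 : ∑ v ∈ S, ∑ w ∈ S, a v w ≤ (S.card : ℝ) ^ 2 := by
      calc _ ≤ ∑ v ∈ S, ∑ w ∈ S, (1 : ℝ) := by
            gcongr; simp only [a]; split_ifs <;> norm_num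
        _ = _ := by simp [sq]
    have h3 : ∀ v, (H.degree v : ℝ) = ∑ w, a v w := by
      intro v
      rw [← ha, ← card_neighborFinset_eq_degree, neighborFinset_eq_filter]
    simp only [Finset.card_univ] at h1
    simp_rw [h3]
    have : 0 ≤ c * ((S.card : ℝ) * (S.card + 1)) := by positivity
    linarith

open Classical in
/-- The **Erdős–Stone theorem**. -/
theorem eventually_completeEquipartiteGraph_isContained_of_sum_degree {ε : ℝ} (hε : 0 < ε)
    (r t : ℕ) :
    ∀ᶠ n : ℕ in atTop, ∀ H : SimpleGraph (Fin n),
      (1 - 1 / r + ε) * (n * (n - 1)) ≤ ∑ v, (H.degree v : ℝ) →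
        completeEquipartiteGraph (r + 1) t ⊑ H := by
  obtain ⟨N, hN⟩ := eventually_atTop.mp
    (eventually_completeEquipartiteGraph_isContained_of_minDegree (half_pos hε) r t)
  set c : ℝ := 1 - 1 / r + ε / 2 with hcdef
  have hc : 0 ≤ c := by
    have : (1 : ℝ) / r ≤ 1 := by
      rw [one_div]; exact Nat.cast_inv_le_one r
    linarith
  have hlim : ∀ᶠ n : ℕ in atTop, 1 + 2 * c + ε ≤ ε / 2 * (n : ℝ) :=
    (tendsto_natCast_atTop_atTop.const_mul_atTop (half_pos hε)).eventually_ge_atTop _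
  filter_upwards [hlim, eventually_ge_atTop ((N + 1) ^ 2)] with n hn1 hn2 H hH
  obtain ⟨S, hS, hScard⟩ := H.exists_finset_le_card_filter_adj hc
  have hSN : N + 1 ≤ S.card := by
    have : ((N + 1 : ℕ) : ℝ) ^ 2 ≤ (S.card : ℝ) ^ 2 := by
      have hn2' : ((N + 1 : ℕ) : ℝ) ^ 2 ≤ n := by exact_mod_cast hn2
      refine hn2'.trans (le_trans ?_ hScard)
      rw [Fintype.card_fin]
      have hn0 : (0 : ℝ) ≤ n := n.cast_nonneg
      have : 1 - 1 / (r : ℝ) + ε = c + ε / 2 := by rw [hcdef]; ring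
      rw [this] at hH
      nlinarith
    have h2 : (N + 1) ^ 2 ≤ S.card ^ 2 := by exact_mod_cast this
    exact (Nat.pow_le_pow_iff_left two_ne_zero).mp h2
  set e := S.equivFin.symm
  let f : Fin S.card → Fin n := fun i => e i
  have hf : Function.Injective f := Subtype.val_injective.comp e.injective
  have hK := hN S.card (by omega) (G := H.comap f) (by
    have : Nonempty (Fin S.card) := ⟨⟨0, by omega⟩⟩
    obtain ⟨v, hv⟩ := (H.comap f).exists_minimal_degree_vertex
    rw [hv]
    refine (hS (f v) (e v).2).trans ?_
    rw [← card_neighborFinset_eq_degree, neighborFinset_eq_filter, ← Finset.card_map ⟨f, hf⟩]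
    refine Nat.cast_le.mpr (Finset.card_le_card fun w hw => ?_)
    obtain ⟨hwS, hw⟩ := Finset.mem_filter.mp hw
    refine Finset.mem_map.mpr ⟨e.symm ⟨w, hwS⟩, ?_, ?_⟩
    · simpa [f] using hw
    · simp [f])
  exact hK.trans ⟨⟨⟨f, fun h => h⟩, hf⟩⟩

open Classical in
/-- A weighted **Erdős–Stone theorem**: if no vertex contained in a triangle has large weight. -/
theorem exists_forall_sum_adj_mul_le {U : Type*} [Finite U] (F : SimpleGraph U) {r : ℕ}
    (hr : 2 ≤ r) (hF : F.Colorable (r + 1)) {ε : ℝ} (hε : 0 < ε) :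
    ∃ δ : ℝ, 0 < δ ∧ ∀ (W : Type*) [Fintype W] (G : SimpleGraph W) (p : W → ℝ),
      (∀ a, 0 ≤ p a) → ∑ a, p a = 1 →
      (∀ a b c, G.Adj a b → G.Adj a c → G.Adj b c → p a ≤ δ) → F.Free G →
        ∑ a, ∑ b, p a * p b * (if G.Adj a b then 1 else 0) ≤ 1 - 1 / r + ε := by
  have := Fintype.ofFinite U
  set t := Fintype.card U
  obtain ⟨n, hn, hn2⟩ := ((eventually_completeEquipartiteGraph_isContained_of_sum_degree
    (half_pos hε) r t).and (eventually_ge_atTop 2)).exists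
  have hn2' : (2 : ℝ) ≤ n := by exact_mod_cast hn2
  -- A repeated triangle vertex is fined n², more than the n(n-1) that all pairs can earn, so a good
  -- sample has none. With this δ the expected fine per pair is at most ε/2.
  refine ⟨ε / 2 / n ^ 2, by positivity, fun W _ G p hp0 hp1 htri hfree => ?_⟩
  by_contra! hlt
  let T : W → Prop := fun a => ∃ b c, G.Adj a b ∧ G.Adj a c ∧ G.Adj b c
  let g : W → W → ℝ := fun a b => (if G.Adj a b then 1 else 0) -
    n ^ 2 * (if a = b ∧ T a then 1 else 0)
  have hT : ∑ a, ∑ b, p a * p b * (if a = b ∧ T a then 1 else 0) ≤ ε / 2 / n ^ 2 := by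
    calc _ ≤ ∑ a, p a * (ε / 2 / n ^ 2) := by
          refine Finset.sum_le_sum fun a _ => ?_
          by_cases hTa : T a
          · obtain ⟨b, c, hab, hac, hbc⟩ := hTa
            simp only [mul_ite, mul_one, mul_zero, ite_and, Finset.sum_ite_eq, Finset.mem_univ,
              if_true]
            split_ifs
            · exact mul_le_mul_of_nonneg_left (htri a b c hab hac hbc) (hp0 a)
            · exact mul_nonneg (hp0 a) (by positivity)
          · simp only [hTa, and_false, if_false, mul_zero, Finset.sum_const_zero]
            exact mul_nonneg (hp0 a) (by positivity)
      _ = _ := by rw [← Finset.sum_mul, hp1, one_mul]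
  have hg : 1 - 1 / r + ε / 2 ≤ ∑ a, ∑ b, p a * p b * g a b := by
    have : ∑ a, ∑ b, p a * p b * g a b =
        ∑ a, ∑ b, p a * p b * (if G.Adj a b then 1 else 0) -
          n ^ 2 * ∑ a, ∑ b, p a * p b * (if a = b ∧ T a then 1 else 0) := by
      simp_rw [Finset.mul_sum, ← Finset.sum_sub_distrib]
      refine Finset.sum_congr rfl fun a _ => Finset.sum_congr rfl fun b _ => ?_
      simp only [g]; ring
    have h2 : (n : ℝ) ^ 2 * ∑ a, ∑ b, p a * p b * (if a = b ∧ T a then 1 else 0) ≤ ε / 2 := by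
      calc _ ≤ (n : ℝ) ^ 2 * (ε / 2 / n ^ 2) := by gcongr
        _ = ε / 2 := by field_simp
    linarith
  obtain ⟨v, hv⟩ := exists_le_sum_offDiag_apply hp0 hp1 n g
  have hr1 : (1 : ℝ) / r ≤ 1 := by rw [one_div]; exact Nat.cast_inv_le_one r
  have hnn : (0 : ℝ) < n * (n - 1) := by nlinarith
  have hv' : (1 - 1 / r + ε / 2) * (n * (n - 1)) ≤
      ∑ ij ∈ (Finset.univ : Finset (Fin n)).offDiag, g (v ij.1) (v ij.2) := by
    refine le_trans ?_ hv
    rw [mul_comm]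
    exact mul_le_mul_of_nonneg_left hg hnn.le
  have hadj_le : ∑ ij ∈ (Finset.univ : Finset (Fin n)).offDiag,
      (if G.Adj (v ij.1) (v ij.2) then (1 : ℝ) else 0) ≤ n * (n - 1) := by
    calc _ ≤ ∑ ij ∈ (Finset.univ : Finset (Fin n)).offDiag, (1 : ℝ) := by
          gcongr; split_ifs <;> norm_num
      _ = _ := by
          rw [Finset.sum_const, Finset.offDiag_card, nsmul_eq_mul, Finset.card_univ,
            Fintype.card_fin, Nat.cast_sub (Nat.le_mul_self n)]
          push_cast; ring
  have hinj : ∀ i j, i ≠ j → v i = v j → ¬ T (v i) := by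
    intro i j hij hvij hTi
    have h1 : (1 : ℝ) ≤ ∑ ij ∈ (Finset.univ : Finset (Fin n)).offDiag,
        (if v ij.1 = v ij.2 ∧ T (v ij.1) then (1 : ℝ) else 0) := by
      have := Finset.single_le_sum (f := fun ij : Fin n × Fin n =>
        if v ij.1 = v ij.2 ∧ T (v ij.1) then (1 : ℝ) else 0)
        (fun ij _ => by split_ifs <;> norm_num)
        (show (i, j) ∈ (Finset.univ : Finset (Fin n)).offDiag by simp [hij])
      simpa only [hvij ▸ hTi, hvij, and_self, if_true] using this
    simp only [g, Finset.sum_sub_distrib, ← Finset.mul_sum] at hv'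
    have h3 : (0 : ℝ) < (1 - 1 / r + ε / 2) * (n * (n - 1)) := by
      apply mul_pos _ hnn; linarith
    nlinarith
  have hdeg : (1 - 1 / r + ε / 2) * (n * (n - 1)) ≤
      ∑ i, ((G.comap v).degree i : ℝ) := by
    refine hv'.trans ?_
    calc _ ≤ ∑ ij ∈ (Finset.univ : Finset (Fin n)).offDiag,
          (if G.Adj (v ij.1) (v ij.2) then (1 : ℝ) else 0) := by
          refine Finset.sum_le_sum fun ij _ => ?_
          simp only [g]
          have : (0 : ℝ) ≤ n ^ 2 * (if v ij.1 = v ij.2 ∧ T (v ij.1) then 1 else 0) := by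
            split_ifs <;> positivity
          linarith
      _ ≤ ∑ ij : Fin n × Fin n, (if G.Adj (v ij.1) (v ij.2) then (1 : ℝ) else 0) :=
          Finset.sum_le_sum_of_subset_of_nonneg (Finset.subset_univ _)
            fun _ _ _ => by split_ifs <;> norm_num
      _ = _ := by
          rw [Fintype.sum_prod_type]
          refine Finset.sum_congr rfl fun i _ => ?_
          rw [← card_neighborFinset_eq_degree, neighborFinset_eq_filter, Finset.card_filter]
          push_cast
          rfl
  obtain ⟨φ⟩ := hn _ hdeg
  -- There are at least three parts, so every vertex of the copy lies in a triangle; the sampled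
  -- vertices it uses are therefore distinct.
  have hφT : ∀ x, T (v (φ x)) := by
    rintro ⟨x, y⟩
    have : Nontrivial (Fin (r + 1)) := Fin.nontrivial_iff_two_le.mpr (by omega)
    obtain ⟨b, hb⟩ : ∃ b : Fin (r + 1), b ≠ x := exists_ne x
    obtain ⟨c, hc⟩ : ∃ c : Fin (r + 1), c ∉ ({x, b} : Finset (Fin (r + 1))) := by
      by_contra! h
      have h1 := Finset.card_le_card fun c (_ : c ∈ Finset.univ) => h c
      have h2 := Finset.card_le_two (a := x) (b := b)
      simp at h1
      omega
    simp only [Finset.mem_insert, Finset.mem_singleton, not_or] at hc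
    have key : ∀ {i j : Fin (r + 1)}, i ≠ j → G.Adj (v (φ (i, y))) (v (φ (j, y))) := by
      intro i j hij
      exact φ.toHom.map_adj (v := (i, y)) (w := (j, y))
        (completeEquipartiteGraph_adj.mpr hij)
    exact ⟨v (φ (b, y)), v (φ (c, y)), key hb.symm, key (Ne.symm hc.1), key (Ne.symm hc.2)⟩
  have hcontain : completeEquipartiteGraph (r + 1) t ⊑ G := by
    refine ⟨⟨⟨fun x => v (φ x), fun {x y} h => φ.toHom.map_adj h⟩, fun x y hxy => ?_⟩⟩
    by_contra hne
    exact hinj _ _ (φ.injective.ne hne) hxy (hφT x)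
  obtain ⟨C⟩ := hF
  exact hfree ((isContained_completeEquipartiteGraph_of_colorable C t
    fun c => Fintype.card_subtype_le _).trans hcontain)

end SimpleGraph

/-! ### Spectral radius against walk counts -/

namespace SimpleGraph

open Classical in
theorem adjSpectralRadius_eq {W : Type*} [Fintype W] (G : SimpleGraph W) :
    G.adjSpectralRadius = (spectralRadius ℝ (G.adjMatrix ℝ)).toReal := rfl

theorem adjSpectralRadius_nonneg {W : Type*} [Fintype W] (G : SimpleGraph W) :
    0 ≤ G.adjSpectralRadius := ENNReal.toReal_nonneg

open Classical in
/-- The spectral radius is compared with the number of walks through the relative entropy of the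
stationary distribution on edges with respect to the product of its marginals. -/
theorem exists_log_pow_sub_log_walkCount_le {W : Type*} [Fintype W] (G : SimpleGraph W)
    (hG : 0 < G.adjSpectralRadius) (k : ℕ) :
    ∃ x : W → ℝ, (∀ i, 0 ≤ x i) ∧ ∑ i, x i ^ 2 = 1 ∧
      ∑ i, ∑ j, G.adjMatrix ℝ i j * x i * x j / G.adjSpectralRadius = 1 ∧
      0 < G.walkCount (k + 1) ∧
      Real.log (G.adjSpectralRadius ^ (k + 1)) - Real.log (G.walkCount (k + 1)) ≤
        ∑ i, ∑ j, G.adjMatrix ℝ i j * x i * x j / G.adjSpectralRadius *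
          Real.log (G.adjSpectralRadius * x i * x j) := by
  have hW : Nonempty W := by
    by_contra h
    rw [not_nonempty_iff] at h
    simp [adjSpectralRadius_eq] at hG
  have hA0 : ∀ i j, 0 ≤ G.adjMatrix ℝ i j := fun i j => by
    rw [adjMatrix_apply]; split_ifs <;> norm_num
  obtain ⟨x, hx0, hx1, hAx⟩ :=
    Matrix.exists_nonneg_eigenvector_spectralRadius G.isSymm_adjMatrix hA0
  rw [← adjSpectralRadius_eq] at hAx
  set c := G.adjSpectralRadius
  set A := G.adjMatrix ℝ
  have hBs : (A ^ k).IsSymm := Matrix.IsSymm.pow G.isSymm_adjMatrix k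
  have hB0 : ∀ i j, 0 ≤ (A ^ k) i j := by
    induction k with
    | zero => intro i j; rw [pow_zero, Matrix.one_apply]; split_ifs <;> norm_num
    | succ k ih =>
      intro i j
      rw [pow_succ, Matrix.mul_apply]
      exact Finset.sum_nonneg fun l _ =>
        mul_nonneg (ih (Matrix.IsSymm.pow G.isSymm_adjMatrix k) _ _) (hA0 _ _)
  have hBx : (A ^ k).mulVec x = c ^ k • x := by
    clear hBs hB0
    induction k with
    | zero => simp
    | succ k ih =>
      rw [pow_succ, ← Matrix.mulVec_mulVec, hAx, Matrix.mulVec_smul, ih, smul_smul, pow_succ,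
        mul_comm]
  have hpos : 0 < ∑ i, ∑ j, (A ^ k) i j := by
    refine lt_of_le_of_ne (Finset.sum_nonneg fun i _ => Finset.sum_nonneg fun j _ => hB0 i j) ?_
    intro h0
    have hz : A ^ k = 0 := by
      ext i j
      have h1 := (Finset.sum_eq_zero_iff_of_nonneg fun i _ =>
        Finset.sum_nonneg fun j _ => hB0 i j).mp h0.symm i (Finset.mem_univ _)
      exact (Finset.sum_eq_zero_iff_of_nonneg fun j _ => hB0 i j).mp h1 j (Finset.mem_univ _)
    rw [hz, Matrix.zero_mulVec] at hBx
    have hxz : x = 0 := by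
      rcases smul_eq_zero.mp hBx.symm with h | h
      · exact absurd h (pow_pos hG k).ne'
      · exact h
    simp [hxz] at hx1
  refine ⟨x, hx0, hx1, ?_, ?_, ?_⟩
  · rw [← hx1]
    refine Finset.sum_congr rfl fun i _ => ?_
    have h := congrFun hAx i
    simp only [Matrix.mulVec, dotProduct, Pi.smul_apply, smul_eq_mul] at h
    have : ∀ j, A i j * x i * x j / c = (x i / c) * (A i j * x j) := fun j => by ring
    simp_rw [this]
    rw [← Finset.mul_sum, h]
    field_simp
  · rw [← G.walkCount_succ k] at hpos
    exact_mod_cast hpos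
  · have h1 := Matrix.log_eigenvalue_sub_le_log_sum hBs hB0 hx0 hx1 (pow_pos hG k) hBx hpos
    have h2 := Matrix.sum_mul_log_eigenvector G.isSymm_adjMatrix hx1 hG hAx
    rw [h2, G.walkCount_succ k, pow_succ, Real.log_mul (pow_pos hG k).ne' hG.ne']
    linarith

/-- Relative entropy is nonnegative. This makes the error 1 admissible for every walk count. -/
theorem adjSpectralRadius_pow_le_walkCount {W : Type*} [Fintype W] (G : SimpleGraph W) {l : ℕ}
    (hl : 1 ≤ l) : G.adjSpectralRadius ^ l ≤ G.walkCount l := by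
  classical
  obtain ⟨k, rfl⟩ := Nat.exists_eq_add_of_le' hl
  rcases G.adjSpectralRadius_nonneg.eq_or_lt with h0 | hG
  · rw [← h0, zero_pow (by omega)]; positivity
  obtain ⟨x, hx0, hx1, hp1, hw, hlog⟩ := G.exists_log_pow_sub_log_walkCount_le hG k
  set c := G.adjSpectralRadius
  have hle : ∑ i, ∑ j, G.adjMatrix ℝ i j * x i * x j / c * Real.log (c * x i * x j) ≤
      ∑ i, ∑ j, (x i ^ 2 * x j ^ 2 - G.adjMatrix ℝ i j * x i * x j / c) := by
    refine Finset.sum_le_sum fun i _ => Finset.sum_le_sum fun j _ => ?_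
    rw [adjMatrix_apply]
    split_ifs
    · rcases (hx0 i).eq_or_lt with hi | hi
      · simp [← hi]
      rcases (hx0 j).eq_or_lt with hj | hj
      · simp [← hj]
      have h1 := Real.log_le_sub_one_of_pos (show 0 < c * x i * x j by positivity)
      have h2 : 0 ≤ 1 * x i * x j / c := by positivity
      calc _ ≤ 1 * x i * x j / c * (c * x i * x j - 1) := mul_le_mul_of_nonneg_left h1 h2
        _ = _ := by field_simp
    · simp only [zero_mul, zero_div, sub_zero]; positivity
  simp_rw [Finset.sum_sub_distrib, hp1, ← Finset.mul_sum, hx1, mul_one, hx1] at hle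
  have hlog' : Real.log (c ^ (k + 1)) ≤ Real.log (G.walkCount (k + 1)) := by linarith
  exact (Real.log_le_log_iff (by positivity) (by exact_mod_cast hw)).mp hlog'

open Classical in
theorem exists_forall_adjSpectralRadius_pow_le {U : Type*} [Finite U] (F : SimpleGraph U) {r : ℕ}
    (hr : 2 ≤ r) (hF : F.Colorable (r + 1)) {ε : ℝ} (hε : 0 < ε) (hεr : ε ≤ 1 / r) :
    ∃ M : ℝ, 0 < M ∧ ∀ (W : Type*) [Fintype W] (G : SimpleGraph W), F.Free G →
      M ≤ G.adjSpectralRadius → ∀ l : ℕ, 1 ≤ l →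
        G.adjSpectralRadius ^ l ≤ (1 - 1 / (r : ℝ) + ε) * G.walkCount l := by
  have hr2 : (1 : ℝ) / r ≤ 1 / 2 := by
    apply one_div_le_one_div_of_le (by norm_num); exact_mod_cast hr
  obtain ⟨δ, hδ, hweight⟩ := exists_forall_sum_adj_mul_le F hr hF (half_pos hε)
  set s : ℝ := 1 - 1 / r + ε / 2 with hs
  have hs1 : 1 / 2 ≤ s := by linarith
  have hs2 : s ≤ 1 := by linarith
  have hlim : Tendsto (fun K : ℝ => 8 / Real.log K + 2 / K + 2 / √K) atTop (𝓝 (0 + 0 + 0)) :=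
    ((Real.tendsto_log_atTop.const_div_atTop 8).add (tendsto_id.const_div_atTop 2)).add
      (Real.tendsto_sqrt_atTop.const_div_atTop 2)
  have hη : 0 < Real.log (1 + ε / 2) := Real.log_pos (by linarith)
  obtain ⟨K, hKη, hK⟩ := ((hlim.eventually_lt_const (by simpa using hη)).and
    (eventually_gt_atTop 1)).exists
  have hK0 : 0 < K := by linarith
  refine ⟨K ^ 3 / δ, by positivity, fun W _ G hfree hM l hl => ?_⟩
  obtain ⟨k, rfl⟩ := Nat.exists_eq_add_of_le' hl
  have hc : 0 < G.adjSpectralRadius := lt_of_lt_of_le (by positivity) hM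
  obtain ⟨x, hx0, hx1, hp1, hw, hlog⟩ := G.exists_log_pow_sub_log_walkCount_le hc k
  set c := G.adjSpectralRadius
  have hw' : (0 : ℝ) < G.walkCount (k + 1) := by exact_mod_cast hw
  set L := ∑ i, ∑ j, G.adjMatrix ℝ i j * x i * x j / c * Real.log (c * x i * x j) with hLdef
  have hA : ∀ i j, 0 ≤ G.adjMatrix ℝ i j ∧ G.adjMatrix ℝ i j ≤ 1 := fun i j => by
    rw [adjMatrix_apply]; split_ifs <;> norm_num
  have hfinish : ∀ z : ℝ, 0 < z → z ≤ 1 - 1 / r + ε → L ≤ Real.log z →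
      c ^ (k + 1) ≤ (1 - 1 / (r : ℝ) + ε) * G.walkCount (k + 1) := by
    intro z hz hzle hLz
    have : Real.log (c ^ (k + 1)) ≤ Real.log (z * G.walkCount (k + 1)) := by
      rw [Real.log_mul hz.ne' hw'.ne']; linarith
    exact ((Real.log_le_log_iff (by positivity) (by positivity)).mp this).trans (by gcongr)
  -- If L < -1, the ratio is below 1/e < 1/2 ≤ 1 - 1/r and there is nothing more to prove.
  by_cases hL : -1 ≤ L
  swap
  · refine hfinish (Real.exp (-1)) (Real.exp_pos _) ?_ ?_
    · have := Real.exp_neg_one_lt_d9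
      linarith
    · rw [Real.log_exp]; linarith
  -- The typical edges; the threshold K³/δ on the spectral radius turns the triangle bound K³ into
  -- weight at most δ.
  let H : SimpleGraph W :=
    { Adj := fun i j => G.Adj i j ∧ 1 / K ≤ c * x i * x j ∧ c * x i * x j ≤ K
      symm := ⟨fun i j h => ⟨h.1.symm, by
        have e : c * x j * x i = c * x i * x j := by ring
        rw [e]; exact h.2⟩⟩
      loopless := ⟨fun i h => G.loopless.irrefl i h.1⟩ }
  have hHG : H ≤ G := fun i j h => h.1
  have htri : ∀ a b d, H.Adj a b → H.Adj a d → H.Adj b d → x a ^ 2 ≤ δ := by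
    intro a b d hab had hbd
    have h1 : c * x a * x b * (c * x a * x d) ≤ K * K := by
      refine mul_le_mul hab.2.2 had.2.2 ?_ hK0.le
      exact mul_nonneg (mul_nonneg hc.le (hx0 a)) (hx0 d)
    have h2 : c * x a ^ 2 * (1 / K) ≤ c * x a ^ 2 * (c * x b * x d) := by
      gcongr; exact hbd.2.1
    have h3 : c * x a ^ 2 * (1 / K) ≤ K * K := by
      refine h2.trans (le_trans (le_of_eq ?_) h1); ring
    have h4 : c * x a ^ 2 ≤ K ^ 3 := by
      rw [mul_one_div, div_le_iff₀ hK0] at h3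
      linarith
    rw [div_le_iff₀ hδ] at hM
    have h5 : c * x a ^ 2 ≤ c * δ := h4.trans hM
    exact le_of_mul_le_mul_left h5 hc
  have hS := hweight W H (fun i => x i ^ 2) (fun i => by positivity) hx1 htri
    fun h => hfree (h.mono_right hHG)
  have hkey := sum_mul_log_le_of_sum_typical_le (ι := W × W)
    (p := fun i => G.adjMatrix ℝ i.1 i.2 * x i.1 * x i.2 / c)
    (b := fun i => G.adjMatrix ℝ i.1 i.2 * (x i.1 ^ 2 * x i.2 ^ 2))
    (t := fun i => c * x i.1 * x i.2)
    (fun i => div_nonneg (mul_nonneg (mul_nonneg (hA _ _).1 (hx0 _)) (hx0 _)) hc.le)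
    (fun i => mul_nonneg (hA _ _).1 (by positivity))
    (fun i => by field_simp)
    (fun i hi => by
      have h1 : x i.1 ≠ 0 := fun h => hi (by simp [h])
      have h2 : x i.2 ≠ 0 := fun h => hi (by simp [h])
      have := (hx0 i.1).lt_of_ne' h1
      have := (hx0 i.2).lt_of_ne' h2
      positivity)
    (by rw [Fintype.sum_prod_type]; exact hp1)
    (by
      rw [Fintype.sum_prod_type]
      calc _ ≤ ∑ i, ∑ j, x i ^ 2 * x j ^ 2 := by
            refine Finset.sum_le_sum fun i _ => Finset.sum_le_sum fun j _ => ?_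
            exact mul_le_of_le_one_left (by positivity) (hA i j).2
        _ = 1 := by simp_rw [← Finset.mul_sum, hx1, mul_one, hx1]
        _ ≤ 1 := le_rfl)
    hK hs1 hs2
    (by
      refine le_trans (le_of_eq ?_) hS
      rw [Finset.sum_filter, Fintype.sum_prod_type]
      refine Finset.sum_congr rfl fun i _ => Finset.sum_congr rfl fun j _ => ?_
      by_cases h1 : G.Adj i j <;>
        by_cases h2 : 1 / K ≤ c * x i * x j ∧ c * x i * x j ≤ K <;>
        simp only [H, adjMatrix_apply, h1, h2, if_true, if_false, true_and, false_and, and_self,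
          mul_one, one_mul, zero_mul, mul_zero])
    (by rw [Fintype.sum_prod_type]; exact hL)
  rw [Fintype.sum_prod_type] at hkey
  refine hfinish (s * (1 + ε / 2)) (by positivity) (by nlinarith) ?_
  rw [Real.log_mul (by positivity) (by positivity)]
  exact hkey.trans (by linarith)

end SimpleGraph

/-! ### Assembling the error function -/

/-- Diagonal choice of a null sequence of admissible errors. -/
theorem exists_tendsto_zero_of_forall_eventually {P : ℕ → ℝ → Prop} (h1 : ∀ n, P n 1)
    (h : ∀ ε > 0, ∀ᶠ n in atTop, P n ε) : ∃ f : ℕ → ℝ, Tendsto f atTop (𝓝 0) ∧ ∀ n, P n (f n) := by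
  classical
  let m : ℕ → ℕ := fun n => Nat.findGreatest (fun k => P n (1 / ((k : ℝ) + 1))) n
  refine ⟨fun n => 1 / ((m n : ℝ) + 1), ?_, fun n => ?_⟩
  · have hm : Tendsto m atTop atTop := by
      refine tendsto_atTop.mpr fun k => ?_
      filter_upwards [h (1 / ((k : ℝ) + 1)) (by positivity), eventually_ge_atTop k] with n hn hkn
      exact Nat.le_findGreatest hkn hn
    exact tendsto_one_div_add_atTop_nhds_zero_nat.comp hm
  · exact Nat.findGreatest_spec (P := fun k => P n (1 / ((k : ℝ) + 1))) (Nat.zero_le n)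
      (by simpa using h1 n)

theorem theorem1p4 {U : Type*} [Finite U] (F : SimpleGraph U) (r : ℕ) (hr : 2 ≤ r)
    (hF : F.chromaticNumber = r + 1) (l : ℕ) (hl : 1 ≤ l) :
    ∃ f : ℕ → ℝ, Tendsto f atTop (𝓝 0) ∧
      ∀ (W : Type*) [Fintype W] (G : SimpleGraph W), F.Free G →
        G.adjSpectralRadius ^ l ≤
          (1 - 1 / (r : ℝ) + f (G.walkCount l)) * (G.walkCount l : ℝ) := by
  have hcol : F.Colorable (r + 1) :=
    SimpleGraph.chromaticNumber_le_iff_colorable.mp (by rw [hF]; push_cast; exact le_rfl)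
  have hr0 : (0 : ℝ) < 1 / r := by
    have : 0 < r := by omega
    positivity
  have hr2 : (1 : ℝ) / r ≤ 1 / 2 := by
    apply one_div_le_one_div_of_le (by norm_num); exact_mod_cast hr
  obtain ⟨f, hf, hfP⟩ := exists_tendsto_zero_of_forall_eventually
    (P := fun w e => ∀ (W : Type _) [Fintype W] (G : SimpleGraph W), F.Free G →
      G.walkCount l = w → G.adjSpectralRadius ^ l ≤ (1 - 1 / (r : ℝ) + e) * w)
    (fun w W _ G _ hw => by
      subst hw
      refine (G.adjSpectralRadius_pow_le_walkCount hl).trans (le_mul_of_one_le_left ?_ ?_)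
      · positivity
      · linarith)
    (fun ε hε => by
      obtain ⟨M, hM, hbound⟩ := SimpleGraph.exists_forall_adjSpectralRadius_pow_le F hr hcol
        (ε := min ε (1 / r)) (lt_min hε hr0) (min_le_right _ _)
      -- Since 1 - 1/r ≥ 1/2, this threshold settles every graph of spectral radius at most M.
      filter_upwards [tendsto_natCast_atTop_atTop.eventually_ge_atTop (2 * M ^ l)]
        with w hwM W _ G hfree hw
      subst hw
      rcases le_total M G.adjSpectralRadius with hle | hle
      · refine (hbound W G hfree hle l hl).trans ?_
        gcongr
        exact min_le_left _ _
      · have h1 : G.adjSpectralRadius ^ l ≤ M ^ l :=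
          pow_le_pow_left₀ G.adjSpectralRadius_nonneg hle l
        have h2 : 0 < M ^ l := by positivity
        nlinarith)
  exact ⟨f, hf, fun W _ G hfree => hfP _ W G hfree rfl⟩
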